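/- Fix an acceptable numbering $\varphi_0,\varphi_1,\dots$ of the partial recursive functions and let $W_e$ be the domain of $\varphi_e$. A class $\mathcal C$ of subsets of $\mathbb N$ is *uniformly r.e.* if $\mathcal C=\{W_i : i\in S\}$ for some r.e. set $S\subseteq\mathbb N$; it is *one-one r.e.* if $S$ can moreover be chosen so that $W_i\neq W_j$ for distinct $i,j\in S$. Let $\eta$ be a positive (that is, recursively enumerable) equivalence relation on $\mathbb N$ with infinitely many equivalence classes. A set is *$\eta$-finite* (resp. *$\eta$-infinite*) if it is a union of finitely many, possibly zero (resp. infinitely many) $\eta$-equivalence classes, and *$\eta$-closed* if it is $\eta$-finite or $\eta$-infinite. Let $a_0<a_1<a_2<\cdots$ be the least elements of the $\eta$-equivalence classes in increasing order, let $A_n$ be the union of the equivalence classes of $a_0,\dots,a_{n-1}$, and let $\mathcal A_\eta=\{A_n : n\in\mathbb N\}$ (the *ascending family* for $\eta$). An *$\eta$-family* is an infinite one-one r.e. class all of whose members are $\eta$-closed. **Proposition.** Every uniformly r.e. class $\mathcal C\supseteq\mathcal A_\eta$ consisting of $\eta$-closed sets is an $\eta$-family. In particular, the class of all $\eta$-finite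 sets and the class of all $\eta$-closed r.e. sets are $\eta$-families. -/

import Mathlib

/-- `W e` is the `e`-th recursively enumerable set: the domain of the `e`-th partial recursive
function in the standard acceptable numbering. -/
def W (e : ℕ) : Set ℕ :=
  {x | ((Denumerable.ofNat Nat.Partrec.Code e).eval x).Dom}

/-- A class of sets is uniformly r.e. if it is `{W i : i ∈ S}` for some r.e. set `S`. -/
def UniformlyRE (C : Set (Set ℕ)) : Prop :=
  ∃ S : Set ℕ, REPred (fun i => i ∈ S) ∧ C = W '' S

/-- A class of sets is one-one r.e. if it is `{W i : i ∈ S}` for some r.e. set `S` on which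
distinct indices give distinct sets. -/
def OneOneRE (C : Set (Set ℕ)) : Prop :=
  ∃ S : Set ℕ, REPred (fun i => i ∈ S) ∧ C = W '' S ∧ Set.InjOn W S

/-- A positive equivalence relation is an equivalence relation on `ℕ` that is recursively
enumerable as a set of pairs. -/
def IsPositive (η : Setoid ℕ) : Prop :=
  REPred (fun p : ℕ × ℕ => η p.1 p.2)

/-- A set is `η`-finite if it is a union of finitely many (possibly no) `η`-classes. -/
def IsEtaFinite (η : Setoid ℕ) (L : Set ℕ) : Prop :=
  ∃ D : Set (Set ℕ), D ⊆ η.classes ∧ D.Finite ∧ L = ⋃₀ D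

/-- A set is `η`-infinite if it is a union of infinitely many `η`-classes. -/
def IsEtaInfinite (η : Setoid ℕ) (L : Set ℕ) : Prop :=
  ∃ D : Set (Set ℕ), D ⊆ η.classes ∧ D.Infinite ∧ L = ⋃₀ D

/-- A set is `η`-closed if it is `η`-finite or `η`-infinite. -/
def IsEtaClosed (η : Setoid ℕ) (L : Set ℕ) : Prop :=
  IsEtaFinite η L ∨ IsEtaInfinite η L

/-- The least representatives `a 0 < a 1 < ...` of the `η`-classes, in increasing order.
(Used only when there are infinitely many classes, so that all `a n` are meaningful.) -/
noncomputable def leastRep (η : Setoid ℕ) (n : ℕ) : ℕ :=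
  Nat.nth (fun x => ∀ y, η x y → x ≤ y) n

/-- `A n = [a 0, ..., a (n - 1)]`, the union of the classes of the first `n` least
representatives. -/
def ascendingSet (η : Setoid ℕ) (n : ℕ) : Set ℕ :=
  {x | ∃ m < n, η x (leastRep η m)}

/-- The ascending family for `η`. -/
def ascendingFamily (η : Setoid ℕ) : Set (Set ℕ) :=
  Set.range (ascendingSet η)

/-- An `η`-family is an infinite one-one r.e. class each of whose members is a union of
`η`-classes. -/
def IsEtaFamily (η : Setoid ℕ) (C : Set (Set ℕ)) : Prop :=
  C.Infinite ∧ OneOneRE C ∧ ∀ L ∈ C, IsEtaClosed η L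

/-! The proof is a Friedberg-style enumeration without repetition, with the ascending family as a
reservoir for discarded sets. Let `L` enumerate the class. A follower `(i, r)` copies `L i` until `L
i` seems, below `r`, to equal some `L j` with `j < i` or some `A n`. It is then released and
completes its finite part to an `A n` whose index codes `i`, `r` and the release stage. That index
is at least the stage, so `A n` already contains the finite part, and distinct followers receive
distinct sets.

All followers of `i` are released exactly when `L i` is an earlier `L j`, some `A n`, or `ℕ`
(`forall_exists_releasedAt_iff`); `ℕ` occurs because the `A n` converge to it. Otherwise exactly one
appointed follower survives and enumerates `L i`. Adding the `A n` that were never handed out, and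
`ℕ` if it belongs to the class, gives `oneOneRE_range`.

It remains to see that the ascending family is uniformly r.e. (`rePred_mem_ascendingSet`) and, for
the two named classes, to enumerate closed sets by saturation. -/

/-! ### Bounded quantifiers over primitive recursive predicates. -/

section Primrec

variable {α β : Type*} [Primcodable α] [Primcodable β]

theorem PrimrecPred.forall_lt_param {p : α → ℕ → Prop} {f : α → ℕ}
    (hp : PrimrecPred fun z : α × ℕ => p z.1 z.2) (hf : Primrec f) :
    PrimrecPred fun a => ∀ x < f a, p a x := by
  have h : PrimrecRel fun (x : ℕ) (a : α) => p a x :=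
    hp.comp (Primrec.pair Primrec.snd Primrec.fst)
  exact (h.forall_mem_list.comp (Primrec.list_range.comp hf) Primrec.id).of_eq (by simp)

theorem PrimrecPred.exists_lt_param {p : α → ℕ → Prop} {f : α → ℕ}
    (hp : PrimrecPred fun z : α × ℕ => p z.1 z.2) (hf : Primrec f) :
    PrimrecPred fun a => ∃ x < f a, p a x := by
  have h : PrimrecRel fun (x : ℕ) (a : α) => p a x :=
    hp.comp (Primrec.pair Primrec.snd Primrec.fst)
  exact (h.exists_mem_list.comp (Primrec.list_range.comp hf) Primrec.id).of_eq (by simp)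

theorem PrimrecPred.exists_mem_list_param {p : α → β → Prop} {f : α → List β}
    (hp : PrimrecPred fun z : α × β => p z.1 z.2) (hf : Primrec f) :
    PrimrecPred fun a => ∃ x ∈ f a, p a x := by
  have h : PrimrecRel fun (x : β) (a : α) => p a x :=
    hp.comp (Primrec.pair Primrec.snd Primrec.fst)
  exact h.exists_mem_list.comp hf Primrec.id

theorem PrimrecPred.iff {p q : α → Prop} (hp : PrimrecPred p) (hq : PrimrecPred q) :
    PrimrecPred fun a => (p a ↔ q a) :=
  ((hp.and hq).or (hp.not.and hq.not)).of_eq fun a => by tauto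

theorem PrimrecPred.rePred {p : α → Prop} (hp : PrimrecPred p) : REPred p := by
  classical
  exact ComputablePred.to_re ⟨inferInstance, hp.decide.to_comp⟩

end Primrec

/-! ### Closure properties of r.e. predicates. -/

namespace REPred

variable {α β : Type*} [Primcodable α] [Primcodable β]

theorem exists_nat {q : α → ℕ → Prop} (hq : PrimrecPred fun z : α × ℕ => q z.1 z.2) :
    REPred fun a => ∃ n, q a n := by
  classical
  have h : Partrec fun a => Nat.rfind fun n => Part.some (decide (q a n)) :=
    Partrec.rfind hq.decide.to_comp.partrec
  refine h.dom_re.of_eq fun a => Nat.rfind_dom.trans ?_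
  constructor
  · rintro ⟨n, hn, -⟩
    exact ⟨n, by simpa using hn⟩
  · rintro ⟨n, hn⟩
    exact ⟨n, by simpa using hn, fun _ => trivial⟩

/-- Every r.e. predicate is the union of an increasing primitive recursive sequence of predicates,
the `s`-th of which holds only of elements with code below `s`. -/
theorem exists_stages {p : α → Prop} (hp : REPred p) :
    ∃ q : α → ℕ → Prop, PrimrecPred (fun z : α × ℕ => q z.1 z.2) ∧
      (∀ a s t, s ≤ t → q a s → q a t) ∧ (∀ a s, q a s → Encodable.encode a < s) ∧
      ∀ a, p a ↔ ∃ s, q a s := by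
  obtain ⟨c, hc⟩ := Nat.Partrec.Code.exists_code.1 hp
  refine ⟨fun a s => (c.evaln s (Encodable.encode a)).isSome, ?_, ?_, ?_, ?_⟩
  · refine PrimrecPred.of_eq (p := fun z : α × ℕ =>
      (c.evaln z.2 (Encodable.encode z.1)).isSome = true) ?_ fun z => Iff.rfl
    refine Primrec.eq.comp (Primrec.option_isSome.comp ?_) (Primrec.const true)
    exact Nat.Partrec.Code.primrec_evaln.comp
      (Primrec.pair (Primrec.pair Primrec.snd (Primrec.const c))
        (Primrec.encode.comp Primrec.fst))
  · intro a s t hst h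
    obtain ⟨v, hv⟩ := Option.isSome_iff_exists.1 h
    exact Option.isSome_iff_exists.2 ⟨v, Nat.Partrec.Code.evaln_mono hst hv⟩
  · intro a s h
    obtain ⟨v, hv⟩ := Option.isSome_iff_exists.1 h
    exact Nat.Partrec.Code.evaln_bound hv
  · intro a
    have h1 : p a ↔ ∃ v, v ∈ c.eval (Encodable.encode a) := by
      rw [hc]
      simp [Encodable.encodek, Part.mem_assert_iff]
    rw [h1]
    simp only [Nat.Partrec.Code.evaln_complete, Option.isSome_iff_exists]
    exact exists_comm

/-- Dovetailing: the search runs over codes of pairs (witness, stage). -/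
theorem exists_of {p : α → β → Prop} (hp : REPred fun z : α × β => p z.1 z.2) :
    REPred fun a => ∃ b, p a b := by
  classical
  obtain ⟨q, hq, -, -, hpq⟩ := hp.exists_stages
  have hg : Primrec fun z : α × ℕ => Option.casesOn (motive := fun _ => Bool)
      (Encodable.decode z.2 : Option (β × ℕ)) false
      (fun w => decide (q (z.1, w.1) w.2)) := by
    refine Primrec.option_casesOn (Primrec.decode.comp Primrec.snd) (Primrec.const false) ?_
    exact hq.decide.comp (Primrec.pair
      (Primrec.pair (Primrec.fst.comp Primrec.fst) (Primrec.fst.comp Primrec.snd))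
      (Primrec.snd.comp Primrec.snd))
  refine (exists_nat (q := fun a n => Option.casesOn (motive := fun _ => Bool)
      (Encodable.decode n : Option (β × ℕ)) false (fun w => decide (q (a, w.1) w.2)) = true)
      (Primrec.eq.comp hg (Primrec.const true))).of_eq fun a => ?_
  constructor
  · rintro ⟨n, hn⟩
    cases h : (Encodable.decode n : Option (β × ℕ)) with
    | none => simp [h] at hn
    | some w => exact ⟨w.1, (hpq (a, w.1)).2 ⟨w.2, by simpa [h] using hn⟩⟩
  · rintro ⟨b, hb⟩
    obtain ⟨s, hs⟩ := (hpq (a, b)).1 hb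
    exact ⟨Encodable.encode (b, s), by simpa using hs⟩

theorem and {p q : α → Prop} (hp : REPred p) (hq : REPred q) : REPred fun a => p a ∧ q a := by
  obtain ⟨p', hp', hpm, -, hpp⟩ := hp.exists_stages
  obtain ⟨q', hq', hqm, -, hqq⟩ := hq.exists_stages
  refine (exists_nat (q := fun a s => p' a s ∧ q' a s) (hp'.and hq')).of_eq fun a => ?_
  rw [hpp, hqq]
  constructor
  · rintro ⟨s, h1, h2⟩
    exact ⟨⟨s, h1⟩, ⟨s, h2⟩⟩
  · rintro ⟨⟨s, h1⟩, ⟨t, h2⟩⟩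
    exact ⟨max s t, hpm _ _ _ (le_max_left _ _) h1, hqm _ _ _ (le_max_right _ _) h2⟩

theorem or {p q : α → Prop} (hp : REPred p) (hq : REPred q) : REPred fun a => p a ∨ q a := by
  obtain ⟨p', hp', -, -, hpp⟩ := hp.exists_stages
  obtain ⟨q', hq', -, -, hqq⟩ := hq.exists_stages
  refine (exists_nat (q := fun a s => p' a s ∨ q' a s) (hp'.or hq')).of_eq fun a => ?_
  rw [hpp, hqq, exists_or]

theorem comp {p : β → Prop} (hp : REPred p) {f : α → β} (hf : Computable f) :
    REPred fun a => p (f a) :=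
  Partrec.comp hp hf

end REPred

/-! ### Indices of uniformly r.e. families. -/

theorem rePred_mem_W : REPred fun z : ℕ × ℕ => z.2 ∈ W z.1 := by
  refine Partrec.dom_re (f := fun z : ℕ × ℕ =>
    (Denumerable.ofNat Nat.Partrec.Code z.1).eval z.2) ?_
  exact Nat.Partrec.Code.eval_part.comp ((Computable.ofNat _).comp Computable.fst) Computable.snd

/-- A uniformly r.e. sequence of sets has a computable sequence of indices. -/
theorem exists_computable_index {α : Type*} [Primcodable α] {R : α → Set ℕ}
    (hR : REPred fun z : α × ℕ => z.2 ∈ R z.1) :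
    ∃ f : α → ℕ, Computable f ∧ ∀ a, W (f a) = R a := by
  obtain ⟨c, hc⟩ := Nat.Partrec.Code.exists_code.1 hR
  -- The s-m-n theorem: the parameter is hard-wired into the code `c`.
  refine ⟨fun a => Encodable.encode (c.curry (Encodable.encode a)), ?_, ?_⟩
  · exact (Primrec.encode.comp (Nat.Partrec.Code.primrec₂_curry.comp (Primrec.const c)
      Primrec.encode)).to_comp
  · intro a
    ext x
    have h : Nat.pair (Encodable.encode a) x = Encodable.encode (a, x) := rfl
    simp only [W, Set.mem_ofPred_eq, Denumerable.ofNat_encode, Nat.Partrec.Code.eval_curry]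
    rw [hc, h]
    simp [Part.assert]

theorem W_surjective {L : Set ℕ} (hL : REPred fun x => x ∈ L) : ∃ e, W e = L := by
  obtain ⟨f, -, hf⟩ := exists_computable_index (α := Unit) (R := fun _ => L)
    (hL.comp Computable.snd)
  exact ⟨f (), hf ()⟩

/-- An injective uniformly r.e. family of sets over an r.e. set of parameters is one-one r.e. -/
theorem OneOneRE.of_injOn {α : Type*} [Primcodable α] {K : Set α} {R : α → Set ℕ}
    (hK : REPred fun a => a ∈ K) (hR : REPred fun z : α × ℕ => z.2 ∈ R z.1)
    (hinj : Set.InjOn R K) : OneOneRE (R '' K) := by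
  obtain ⟨f, hf, hW⟩ := exists_computable_index hR
  refine ⟨f '' K, ?_, ?_, ?_⟩
  · refine REPred.of_eq (REPred.exists_of (p := fun (e : ℕ) (a : α) => a ∈ K ∧ f a = e)
      ((hK.comp Computable.snd).and ?_)) fun e => Iff.rfl
    refine (PrimrecPred.rePred (p := fun z : ℕ × ℕ => z.1 = z.2) ?_).comp
      (f := fun z : ℕ × α => (f z.2, z.1))
      (Computable.pair (hf.comp Computable.snd) Computable.fst)
    exact Primrec.eq
  · rw [Set.image_image]
    simp only [hW]
  · rintro _ ⟨a, ha, rfl⟩ _ ⟨b, hb, rfl⟩ h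
    rw [hW, hW] at h
    rw [hinj ha hb h]

/-! ### Stagewise enumerations and their limits. -/

/-- `T i x s` says that `x` has been enumerated into `X i` before stage `s`, in a primitive
recursive simultaneous enumeration of the sets `X i`. -/
structure IsEnumeration (T : ℕ → ℕ → ℕ → Prop) (X : ℕ → Set ℕ) : Prop where
  primrec : PrimrecPred fun z : (ℕ × ℕ) × ℕ => T z.1.1 z.1.2 z.2
  mono : ∀ {i x s t}, s ≤ t → T i x s → T i x t
  lt : ∀ {i x s}, T i x s → x < s
  mem_iff : ∀ {i x}, x ∈ X i ↔ ∃ s, T i x s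

theorem REPred.exists_enumeration {X : ℕ → Set ℕ} (hX : REPred fun z : ℕ × ℕ => z.2 ∈ X z.1) :
    ∃ T, IsEnumeration T X := by
  obtain ⟨q, hq, hm, hb, hi⟩ := hX.exists_stages
  exact ⟨fun i x s => q (i, x) s, hq, fun h => hm _ _ _ h,
    fun h => (Nat.right_le_pair _ _).trans_lt (hb _ _ h), hi (_, _)⟩

/-- An increasing r.e. sequence of sets has an enumeration that is increasing at each stage. -/
theorem REPred.exists_monotone_enumeration {X : ℕ → Set ℕ}
    (hX : REPred fun z : ℕ × ℕ => z.2 ∈ X z.1) (hmono : Monotone X) :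
    ∃ T, IsEnumeration T X ∧ ∀ {m n x s}, m ≤ n → T m x s → T n x s := by
  obtain ⟨T, hT⟩ := hX.exists_enumeration
  -- Stage `s` of `n` collects stage `s` of every `m ≤ n`; monotonicity of `X` keeps the limit
  -- unchanged.
  refine ⟨fun n x s => ∃ m < n + 1, T m x s, ⟨?_, ?_, ?_, ?_⟩, ?_⟩
  · refine PrimrecPred.exists_lt_param (p := fun (z : (ℕ × ℕ) × ℕ) m => T m z.1.2 z.2) ?_
      (Primrec.succ.comp (Primrec.fst.comp Primrec.fst))
    exact hT.primrec.comp (Primrec.pair (Primrec.pair Primrec.snd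
      (Primrec.snd.comp (Primrec.fst.comp Primrec.fst))) (Primrec.snd.comp Primrec.fst))
  · rintro i x s t hst ⟨m, hm, h⟩
    exact ⟨m, hm, hT.mono hst h⟩
  · rintro i x s ⟨m, -, h⟩
    exact hT.lt h
  · intro n x
    constructor
    · intro h
      obtain ⟨s, hs⟩ := hT.mem_iff.1 h
      exact ⟨s, n, n.lt_succ_self, hs⟩
    · rintro ⟨s, m, hm, h⟩
      exact hmono (Nat.lt_succ_iff.1 hm) (hT.mem_iff.2 ⟨s, h⟩)
  · rintro m n x s hmn ⟨k, hk, h⟩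
    exact ⟨k, by omega, h⟩

namespace IsEnumeration

open Filter

variable {T U : ℕ → ℕ → ℕ → Prop} {X Y : ℕ → Set ℕ}

theorem eventually_iff (hT : IsEnumeration T X) (i x : ℕ) :
    ∀ᶠ s in atTop, (T i x s ↔ x ∈ X i) := by
  by_cases h : x ∈ X i
  · obtain ⟨s, hs⟩ := hT.mem_iff.1 h
    filter_upwards [eventually_ge_atTop s] with t ht
    exact iff_of_true (hT.mono ht hs) h
  · exact Eventually.of_forall fun s => iff_of_false (fun hs => h (hT.mem_iff.2 ⟨s, hs⟩)) h

theorem eventually_agree (hT : IsEnumeration T X) (hU : IsEnumeration U Y) {i j N : ℕ}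
    (h : ∀ x < N, x ∈ X i ↔ x ∈ Y j) :
    ∀ᶠ s in atTop, ∀ x < N, (T i x s ↔ U j x s) := by
  refine (eventually_all_finite (Set.finite_lt_nat N)).2 fun x hx => ?_
  filter_upwards [hT.eventually_iff i x, hU.eventually_iff j x] with s h1 h2
  rw [h1, h2]
  exact h x hx

theorem eventually_ne (hT : IsEnumeration T X) (hU : IsEnumeration U Y) {i j : ℕ}
    (h : X i ≠ Y j) :
    ∀ᶠ N in atTop, ∀ s ≥ N, ∃ x < N, ¬(T i x s ↔ U j x s) := by
  obtain ⟨x, hx⟩ : ∃ x, ¬(x ∈ X i ↔ x ∈ Y j) := by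
    by_contra! hc
    exact h (Set.ext hc)
  filter_upwards [eventually_gt_atTop x,
    eventually_forall_ge_atTop.2 ((hT.eventually_iff i x).and (hU.eventually_iff j x))] with N hN hs s hsN
  refine ⟨x, hN, ?_⟩
  rw [(hs s hsN).1, (hs s hsN).2]
  exact hx

end IsEnumeration

/-! ### The Friedberg construction: followers and their release. -/

section Friedberg

/-- At stage `s`, the set with index `i` agrees below `r` with one of smaller index or with a
member of the reserved sequence. -/
def LooksRedundant (T U : ℕ → ℕ → ℕ → Prop) (i r s : ℕ) : Prop :=
  (∃ j < i, ∀ x < r, (T i x s ↔ T j x s)) ∨ ∃ n < s + 1, ∀ x < r, (T i x s ↔ U n x s)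

/-- The follower of `i` appointed at stage `r` is released at stage `t`. -/
def ReleasedAt (T U : ℕ → ℕ → ℕ → Prop) (i r t : ℕ) : Prop :=
  (r ≤ t ∧ LooksRedundant T U i r t) ∧ ∀ s < t, ¬(r ≤ s ∧ LooksRedundant T U i r s)

/-- The index of the member of the reserved sequence which the follower of `i` appointed at `r`
and released at `t` ends up enumerating. -/
def releaseIndex (i r t : ℕ) : ℕ := Nat.pair (Nat.pair i r) t

/-- The set enumerated by the follower of `i` appointed at stage `r`. -/
def followerSet (T U : ℕ → ℕ → ℕ → Prop) (A : ℕ → Set ℕ) (z : ℕ × ℕ) : Set ℕ :=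
  {x | (∃ s, T z.1 x s ∧ ∀ t < s + 1, ¬ReleasedAt T U z.1 z.2 t) ∨
    ∃ t, ReleasedAt T U z.1 z.2 t ∧ x ∈ A (releaseIndex z.1 z.2 t)}

/-- A follower is appointed at stage `0`, and at each later stage at which the hypothetical
follower appointed one stage earlier turns out to be released. -/
def IsAppointed (T U : ℕ → ℕ → ℕ → Prop) (z : ℕ × ℕ) : Prop :=
  z.2 = 0 ∨ ∃ t, ReleasedAt T U z.1 (z.2 - 1) t

/-- `n` is the release index of some follower. -/
def IsReleaseIndex (T U : ℕ → ℕ → ℕ → Prop) (n : ℕ) : Prop :=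
  ReleasedAt T U n.unpair.1.unpair.1 n.unpair.1.unpair.2 n.unpair.2

variable {T U : ℕ → ℕ → ℕ → Prop} {L A : ℕ → Set ℕ} {i j r r' s t : ℕ}

theorem LooksRedundant.anti (hr : r ≤ r') (h : LooksRedundant T U i r' s) :
    LooksRedundant T U i r s := by
  rcases h with ⟨j, hj, h⟩ | ⟨n, hn, h⟩
  · exact Or.inl ⟨j, hj, fun x hx => h x (hx.trans_le hr)⟩
  · exact Or.inr ⟨n, hn, fun x hx => h x (hx.trans_le hr)⟩

theorem exists_releasedAt_iff :
    (∃ t, ReleasedAt T U i r t) ↔ ∃ s, r ≤ s ∧ LooksRedundant T U i r s := by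
  classical
  constructor
  · rintro ⟨t, h, -⟩
    exact ⟨t, h⟩
  · intro h
    exact ⟨Nat.find h, Nat.find_spec h, fun s hs => Nat.find_min h hs⟩

theorem ReleasedAt.unique (hs : ReleasedAt T U i r s) (ht : ReleasedAt T U i r t) : s = t := by
  rcases lt_trichotomy s t with h | h | h
  · exact (ht.2 s h hs.1).elim
  · exact h
  · exact (hs.2 t h ht.1).elim

/-- Agreement below `r'` contains agreement below `r`, so the released followers of `i` form an
initial segment. -/
theorem exists_releasedAt_anti (hr : r ≤ r') (h : ∃ t, ReleasedAt T U i r' t) :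
    ∃ t, ReleasedAt T U i r t := by
  rw [exists_releasedAt_iff] at h ⊢
  obtain ⟨s, hs, h⟩ := h
  exact ⟨s, hr.trans hs, h.anti hr⟩

theorem ReleasedAt.isAppointed (h : ReleasedAt T U i r t) : IsAppointed T U (i, r) :=
  Or.inr (exists_releasedAt_anti (Nat.sub_le _ _) ⟨t, h⟩)

theorem isReleaseIndex_releaseIndex :
    IsReleaseIndex T U (releaseIndex i r t) ↔ ReleasedAt T U i r t := by
  simp [IsReleaseIndex, releaseIndex]

theorem IsReleaseIndex.exists_eq {n : ℕ} (h : IsReleaseIndex T U n) :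
    ∃ i r t, ReleasedAt T U i r t ∧ releaseIndex i r t = n :=
  ⟨_, _, _, h, by simp [releaseIndex]⟩

theorem followerSet_of_not_released (hT : IsEnumeration T L)
    (h : ¬∃ t, ReleasedAt T U i r t) : followerSet T U A (i, r) = L i := by
  ext x
  push Not at h
  simp [followerSet, h, hT.mem_iff]

theorem ReleasedAt.followerSet_eq (hT : IsEnumeration T L) (hA : ∀ n, ∀ x < n, x ∈ A n)
    (h : ReleasedAt T U i r t) : followerSet T U A (i, r) = A (releaseIndex i r t) := by
  ext x
  constructor
  · rintro (⟨s, hs, hns⟩ | ⟨t', ht', hx⟩)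
    · have hst : s < t := by
        by_contra! hc
        exact hns t (by omega) h
      -- What was copied before release satisfies `x < s < t`, and `t` is at most the code, so the
      -- new set swallows it.
      exact hA _ x (((hT.lt hs).trans hst).trans_le (Nat.right_le_pair _ _))
    · rwa [h.unique ht']
  · exact fun hx => Or.inr ⟨t, h, hx⟩

/-- Every follower of `i` is released just when `L i` need not be enumerated by a follower. -/
theorem forall_exists_releasedAt_iff (hT : IsEnumeration T L) (hU : IsEnumeration U A)
    (hUmono : ∀ {m n x s}, m ≤ n → U m x s → U n x s) (hA : ∀ n, ∀ x < n, x ∈ A n) :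
    (∀ r, ∃ t, ReleasedAt T U i r t) ↔
      L i ∈ Set.range A ∨ L i = Set.univ ∨ ∃ j < i, L i = L j := by
  simp only [exists_releasedAt_iff]
  constructor
  · intro h
    by_contra! hc
    obtain ⟨h1, h2, h3⟩ := hc
    -- A point `y` outside `L i` rules out all `A n` with `n > y` at once, leaving finitely many
    -- sets to separate from `L i`.
    obtain ⟨y, hy⟩ := (Set.ne_univ_iff_exists_notMem _).1 h2
    have e1 : ∀ᶠ N in Filter.atTop, ∀ j < i, ∀ s ≥ N, ∃ x < N, ¬(T i x s ↔ T j x s) :=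
      (Filter.eventually_all_finite (Set.finite_lt_nat i)).2 fun j hj =>
        hT.eventually_ne hT (h3 j hj)
    have e2 : ∀ᶠ N in Filter.atTop, ∀ n < y + 1, ∀ s ≥ N, ∃ x < N, ¬(T i x s ↔ U n x s) :=
      (Filter.eventually_all_finite (Set.finite_lt_nat (y + 1))).2 fun n _ =>
        hT.eventually_ne hU fun he => h1 ⟨n, he.symm⟩
    have e3 := Filter.eventually_forall_ge_atTop.2 (hU.eventually_iff (y + 1) y)
    obtain ⟨N, ⟨h4, h5⟩, h6, h7⟩ :=
      ((e1.and e2).and (e3.and (Filter.eventually_gt_atTop y))).exists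
    obtain ⟨s, hs, ⟨j, hj, hV⟩ | ⟨n, -, hV⟩⟩ := h N
    · obtain ⟨x, hx, hne⟩ := h4 j hj s hs
      exact hne (hV x hx)
    · rcases lt_or_ge n (y + 1) with hn | hn
      · obtain ⟨x, hx, hne⟩ := h5 n hn s hs
        exact hne (hV x hx)
      · have hUy := hUmono hn ((h6 s hs).2 (hA _ _ y.lt_succ_self))
        exact hy (hT.mem_iff.2 ⟨s, (hV y h7).2 hUy⟩)
  · rintro h r
    have key : ∀ n, (∀ x < r, x ∈ L i ↔ x ∈ A n) → ∃ s, r ≤ s ∧ LooksRedundant T U i r s := by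
      intro n hn
      obtain ⟨s, ⟨h1, h2⟩, h3⟩ := (((hT.eventually_agree hU hn).and
        (Filter.eventually_ge_atTop r)).and (Filter.eventually_ge_atTop n)).exists
      exact ⟨s, h2, Or.inr ⟨n, Nat.lt_succ_iff.2 h3, h1⟩⟩
    rcases h with ⟨n, hn⟩ | h | ⟨j, hj, h⟩
    · exact key n fun x _ => by rw [hn]
    -- `A r` contains everything below `r`, hence is indistinguishable there from `ℕ`.
    · exact key r fun x hx => iff_of_true (h ▸ Set.mem_univ x) (hA r x hx)
    · obtain ⟨s, h1, h2⟩ := ((hT.eventually_agree hT (i := i) (j := j) (N := r)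
        fun x _ => by rw [h]).and (Filter.eventually_ge_atTop r)).exists
      exact ⟨s, h2, Or.inl ⟨j, hj, h1⟩⟩

theorem primrecPred_looksRedundant (hT : IsEnumeration T L) (hU : IsEnumeration U A) :
    PrimrecPred fun z : (ℕ × ℕ) × ℕ => LooksRedundant T U z.1.1 z.1.2 z.2 := by
  have comp3 : ∀ {V : ℕ → ℕ → ℕ → Prop} {α : Type} [Primcodable α] {f g h : α → ℕ},
      (PrimrecPred fun z : (ℕ × ℕ) × ℕ => V z.1.1 z.1.2 z.2) → Primrec f → Primrec g →
      Primrec h → PrimrecPred fun a => V (f a) (g a) (h a) :=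
    fun hV hf hg hh => hV.comp (Primrec.pair (Primrec.pair hf hg) hh)
  have hi : Primrec fun w : (((ℕ × ℕ) × ℕ) × ℕ) × ℕ => w.1.1.1.1 :=
    Primrec.fst.comp (Primrec.fst.comp (Primrec.fst.comp Primrec.fst))
  have hs : Primrec fun w : (((ℕ × ℕ) × ℕ) × ℕ) × ℕ => w.1.1.2 :=
    Primrec.snd.comp (Primrec.fst.comp Primrec.fst)
  have hj : Primrec fun w : (((ℕ × ℕ) × ℕ) × ℕ) × ℕ => w.1.2 := Primrec.snd.comp Primrec.fst
  have hr : Primrec fun w : ((ℕ × ℕ) × ℕ) × ℕ => w.1.1.2 :=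
    Primrec.snd.comp (Primrec.fst.comp Primrec.fst)
  refine PrimrecPred.or ?_ ?_
  · refine PrimrecPred.exists_lt_param (p := fun (z : (ℕ × ℕ) × ℕ) j =>
      ∀ x < z.1.2, (T z.1.1 x z.2 ↔ T j x z.2)) ?_ (Primrec.fst.comp Primrec.fst)
    refine PrimrecPred.forall_lt_param (p := fun (w : ((ℕ × ℕ) × ℕ) × ℕ) x =>
      (T w.1.1.1 x w.1.2 ↔ T w.2 x w.1.2)) ?_ hr
    exact (comp3 hT.primrec hi Primrec.snd hs).iff (comp3 hT.primrec hj Primrec.snd hs)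
  · refine PrimrecPred.exists_lt_param (p := fun (z : (ℕ × ℕ) × ℕ) n =>
      ∀ x < z.1.2, (T z.1.1 x z.2 ↔ U n x z.2)) ?_ (Primrec.succ.comp Primrec.snd)
    refine PrimrecPred.forall_lt_param (p := fun (w : ((ℕ × ℕ) × ℕ) × ℕ) x =>
      (T w.1.1.1 x w.1.2 ↔ U w.2 x w.1.2)) ?_ hr
    exact (comp3 hT.primrec hi Primrec.snd hs).iff (comp3 hU.primrec hj Primrec.snd hs)

theorem primrecPred_releasedAt (hT : IsEnumeration T L) (hU : IsEnumeration U A) :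
    PrimrecPred fun z : (ℕ × ℕ) × ℕ => ReleasedAt T U z.1.1 z.1.2 z.2 := by
  have h : PrimrecPred fun z : (ℕ × ℕ) × ℕ =>
      z.1.2 ≤ z.2 ∧ LooksRedundant T U z.1.1 z.1.2 z.2 :=
    (Primrec.nat_le.comp (Primrec.snd.comp Primrec.fst) Primrec.snd).and
      (primrecPred_looksRedundant hT hU)
  refine h.and (PrimrecPred.forall_lt_param (p := fun (z : (ℕ × ℕ) × ℕ) s =>
    ¬(z.1.2 ≤ s ∧ LooksRedundant T U z.1.1 z.1.2 s)) ?_ Primrec.snd)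
  exact (h.comp (Primrec.pair (Primrec.fst.comp Primrec.fst) Primrec.snd)).not

theorem rePred_isAppointed (hT : IsEnumeration T L) (hU : IsEnumeration U A) :
    REPred fun z : ℕ × ℕ => IsAppointed T U z := by
  refine REPred.or ?_ ?_
  · exact PrimrecPred.rePred (Primrec.eq.comp Primrec.snd (Primrec.const 0))
  · refine REPred.exists_nat (q := fun (z : ℕ × ℕ) t => ReleasedAt T U z.1 (z.2 - 1) t) ?_
    exact (primrecPred_releasedAt hT hU).comp (Primrec.pair
      (Primrec.pair (Primrec.fst.comp Primrec.fst)
        (Primrec.pred.comp (Primrec.snd.comp Primrec.fst))) Primrec.snd)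

theorem rePred_mem_followerSet (hT : IsEnumeration T L) (hU : IsEnumeration U A)
    (hAre : REPred fun z : ℕ × ℕ => z.2 ∈ A z.1) :
    REPred fun w : (ℕ × ℕ) × ℕ => w.2 ∈ followerSet T U A w.1 := by
  have hrel := primrecPred_releasedAt hT hU
  refine REPred.or ?_ ?_
  · refine REPred.exists_nat (q := fun (w : (ℕ × ℕ) × ℕ) s =>
      T w.1.1 w.2 s ∧ ∀ t < s + 1, ¬ReleasedAt T U w.1.1 w.1.2 t) (PrimrecPred.and ?_ ?_)
    · exact hT.primrec.comp (Primrec.pair (Primrec.pair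
        (Primrec.fst.comp (Primrec.fst.comp Primrec.fst)) (Primrec.snd.comp Primrec.fst))
        Primrec.snd)
    · refine PrimrecPred.forall_lt_param (p := fun (v : ((ℕ × ℕ) × ℕ) × ℕ) t =>
        ¬ReleasedAt T U v.1.1.1 v.1.1.2 t) ?_ (Primrec.succ.comp Primrec.snd)
      exact (hrel.comp (Primrec.pair (Primrec.fst.comp (Primrec.fst.comp Primrec.fst))
        Primrec.snd)).not
  · refine REPred.exists_of (p := fun (w : (ℕ × ℕ) × ℕ) t =>
      ReleasedAt T U w.1.1 w.1.2 t ∧ w.2 ∈ A (releaseIndex w.1.1 w.1.2 t)) (REPred.and ?_ ?_)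
    · exact (hrel.comp (Primrec.pair (Primrec.fst.comp Primrec.fst) Primrec.snd)).rePred
    · refine hAre.comp (f := fun v : ((ℕ × ℕ) × ℕ) × ℕ =>
        (Nat.pair (Nat.pair v.1.1.1 v.1.1.2) v.2, v.1.2)) (Primrec.to_comp ?_)
      refine Primrec.pair (Primrec₂.natPair.comp ?_ Primrec.snd) (Primrec.snd.comp Primrec.fst)
      exact Primrec₂.natPair.comp (Primrec.fst.comp (Primrec.fst.comp Primrec.fst))
        (Primrec.snd.comp (Primrec.fst.comp Primrec.fst))

/-- Coding the release stage into the index makes this decidable, so the indices never handed out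
also form an r.e. set. -/
theorem primrecPred_isReleaseIndex (hT : IsEnumeration T L) (hU : IsEnumeration U A) :
    PrimrecPred fun n => IsReleaseIndex T U n := by
  refine (primrecPred_releasedAt hT hU).comp
    (f := fun n : ℕ => (n.unpair.1.unpair, n.unpair.2)) ?_
  exact Primrec.pair (Primrec.unpair.comp (Primrec.fst.comp Primrec.unpair))
    (Primrec.snd.comp Primrec.unpair)

end Friedberg

/-! ### Assembling the one-one enumeration. -/

theorem OneOneRE.union {C D : Set (Set ℕ)} (hC : OneOneRE C) (hD : OneOneRE D)
    (h : ∀ X ∈ C, X ∉ D) : OneOneRE (C ∪ D) := by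
  obtain ⟨S, hS, rfl, hSi⟩ := hC
  obtain ⟨S', hS', rfl, hSi'⟩ := hD
  refine ⟨S ∪ S', hS.or hS', (Set.image_union ..).symm, ?_⟩
  rintro a (ha | ha) b (hb | hb) hab
  · exact hSi ha hb hab
  · exact (h _ ⟨a, ha, rfl⟩ ⟨b, hb, hab.symm⟩).elim
  · exact (h _ ⟨b, hb, rfl⟩ ⟨a, ha, hab⟩).elim
  · exact hSi' ha hb hab

theorem OneOneRE.empty : OneOneRE ∅ :=
  ⟨∅, PrimrecPred.rePred ((PrimrecPred.not (Primrec.eq.comp (Primrec.const 0)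
    (Primrec.const 0))).of_eq fun _ => by simp), by simp, by simp⟩

theorem OneOneRE.singleton_univ : OneOneRE {Set.univ} := by
  have h := OneOneRE.of_injOn (α := Unit) (K := Set.univ) (R := fun _ => Set.univ)
    (PrimrecPred.rePred ((Primrec.eq.comp (Primrec.const 0) (Primrec.const 0)).of_eq
      fun _ => by simp))
    (PrimrecPred.rePred ((Primrec.eq.comp (Primrec.const 0) (Primrec.const 0)).of_eq
      fun _ => by simp)) (fun _ _ _ _ _ => rfl)
  simpa using h

/-- A uniformly r.e. sequence of sets that contains all members of a strictly increasing
uniformly r.e. sequence exhausting `ℕ` has a one-one r.e. range. -/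
theorem oneOneRE_range {L A : ℕ → Set ℕ} (hL : REPred fun z : ℕ × ℕ => z.2 ∈ L z.1)
    (hAre : REPred fun z : ℕ × ℕ => z.2 ∈ A z.1) (hmono : StrictMono A)
    (hA : ∀ n, ∀ x < n, x ∈ A n) (hsub : Set.range A ⊆ Set.range L) :
    OneOneRE (Set.range L) := by
  obtain ⟨T, hT⟩ := hL.exists_enumeration
  obtain ⟨U, hU, hUmono⟩ := hAre.exists_monotone_enumeration hmono.monotone
  have hrel : ∀ i, (∀ r, ∃ t, ReleasedAt T U i r t) ↔
      L i ∈ Set.range A ∨ L i = Set.univ ∨ ∃ j < i, L i = L j :=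
    fun i => forall_exists_releasedAt_iff hT hU hUmono hA
  have hAuniv : ∀ n, A n ≠ Set.univ := fun n h =>
    (hmono n.lt_succ_self).not_ge (h ▸ Set.subset_univ _)
  have hfol : OneOneRE (followerSet T U A '' {z | IsAppointed T U z}) := by
    refine OneOneRE.of_injOn (rePred_isAppointed hT hU) (rePred_mem_followerSet hT hU hAre) ?_
    rintro ⟨i, r⟩ hi ⟨j, r'⟩ hj h
    by_cases h1 : ∃ t, ReleasedAt T U i r t <;> by_cases h2 : ∃ t, ReleasedAt T U j r' t
    · obtain ⟨t, h1⟩ := h1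
      obtain ⟨t', h2⟩ := h2
      rw [h1.followerSet_eq hT hA, h2.followerSet_eq hT hA] at h
      have := hmono.injective h
      simp only [releaseIndex, Nat.pair_eq_pair] at this
      ext <;> simp [this]
    · obtain ⟨t, h1⟩ := h1
      rw [h1.followerSet_eq hT hA, followerSet_of_not_released hT h2] at h
      exact (h2 ((hrel j).2 (Or.inl ⟨_, h⟩) r')).elim
    · obtain ⟨t, h2⟩ := h2
      rw [h2.followerSet_eq hT hA, followerSet_of_not_released hT h1] at h
      exact (h1 ((hrel i).2 (Or.inl ⟨_, h.symm⟩) r)).elim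
    · rw [followerSet_of_not_released hT h1, followerSet_of_not_released hT h2] at h
      have hij : i = j := by
        rcases lt_trichotomy i j with hlt | hlt | hlt
        · exact (h2 ((hrel j).2 (Or.inr (Or.inr ⟨i, hlt, h.symm⟩)) r')).elim
        · exact hlt
        · exact (h1 ((hrel i).2 (Or.inr (Or.inr ⟨j, hlt, h⟩)) r)).elim
      subst hij
      -- Appointment of `r' > 0` means that `r' - 1`, and with it everything below, was released; so
      -- no appointed follower lies beyond an unreleased one.
      have aux : ∀ {r r'}, IsAppointed T U (i, r') → (¬∃ t, ReleasedAt T U i r t) → r' ≤ r := by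
        intro r r' ha hr
        by_contra! hlt
        rcases ha with h0 | h0
        · simp only at h0
          omega
        · exact hr (exists_releasedAt_anti (by simp only; omega) h0)
      rw [le_antisymm (aux hi h2) (aux hj h1)]
  have hrest : OneOneRE (A '' {n | ¬IsReleaseIndex T U n}) :=
    OneOneRE.of_injOn (primrecPred_isReleaseIndex hT hU).not.rePred hAre
      hmono.injective.injOn
  -- A nonconstructive case split suffices: only the existence of an index set is needed.
  have huniv : OneOneRE (Set.range L ∩ {Set.univ}) := by
    by_cases h : Set.univ ∈ Set.range L
    · rw [Set.inter_eq_right.2 (Set.singleton_subset_iff.2 h)]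
      exact OneOneRE.singleton_univ
    · rw [Set.inter_singleton_eq_empty.2 h]
      exact OneOneRE.empty
  have hsplit : Set.range L = followerSet T U A '' {z | IsAppointed T U z} ∪
      A '' {n | ¬IsReleaseIndex T U n} ∪ (Set.range L ∩ {Set.univ}) := by
    apply Set.Subset.antisymm
    · rintro X ⟨i, rfl⟩
      by_cases hu : L i = Set.univ
      · exact Or.inr ⟨⟨i, rfl⟩, hu⟩
      left
      by_cases ha : L i ∈ Set.range A
      · obtain ⟨n, hn⟩ := ha
        rw [← hn]
        by_cases hr : IsReleaseIndex T U n
        · obtain ⟨j, r, t, h, rfl⟩ := hr.exists_eq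
          exact Or.inl ⟨(j, r), h.isAppointed, h.followerSet_eq hT hA⟩
        · exact Or.inr ⟨n, hr, rfl⟩
      · left
        classical
        -- The least index `j` of the set, with its least unreleased follower, gives the surviving
        -- follower.
        have hex : ∃ j, L j = L i := ⟨i, rfl⟩
        obtain ⟨j, hj, hmin⟩ : ∃ j, L j = L i ∧ ∀ k < j, L k ≠ L i :=
          ⟨Nat.find hex, Nat.find_spec hex, fun k hk => Nat.find_min hex hk⟩
        have hun : ∃ r, ¬∃ t, ReleasedAt T U j r t := by
          by_contra! hc
          rcases (hrel j).1 hc with h | h | ⟨k, hk, h⟩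
          · exact ha (hj ▸ h)
          · exact hu (hj ▸ h)
          · exact hmin k hk (h ▸ hj)
        refine ⟨(j, Nat.find hun), ?_, ?_⟩
        · rcases Nat.eq_zero_or_pos (Nat.find hun) with h0 | h0
          · exact Or.inl h0
          · exact Or.inr (not_not.1 (Nat.find_min hun (Nat.sub_lt h0 one_pos)))
        · rw [followerSet_of_not_released hT (Nat.find_spec hun), hj]
    · rintro X ((⟨⟨i, r⟩, -, rfl⟩ | ⟨n, -, rfl⟩) | ⟨h, -⟩)
      · by_cases h : ∃ t, ReleasedAt T U i r t
        · obtain ⟨t, h⟩ := h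
          rw [h.followerSet_eq hT hA]
          exact hsub ⟨_, rfl⟩
        · rw [followerSet_of_not_released hT h]
          exact ⟨i, rfl⟩
      · exact hsub ⟨n, rfl⟩
      · exact h
  rw [hsplit]
  refine (hfol.union hrest ?_).union huniv ?_
  · rintro _ ⟨⟨i, r⟩, -, rfl⟩ ⟨n, hn, h⟩
    by_cases hr : ∃ t, ReleasedAt T U i r t
    · obtain ⟨t, hr⟩ := hr
      rw [hr.followerSet_eq hT hA] at h
      rw [hmono.injective h] at hn
      exact hn (isReleaseIndex_releaseIndex.2 hr)
    · rw [followerSet_of_not_released hT hr] at h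
      exact hr ((hrel i).2 (Or.inl ⟨n, h⟩) r)
  · rintro _ (⟨⟨i, r⟩, -, rfl⟩ | ⟨n, -, rfl⟩) ⟨-, h⟩
    · by_cases hr : ∃ t, ReleasedAt T U i r t
      · obtain ⟨t, hr⟩ := hr
        rw [hr.followerSet_eq hT hA] at h
        exact hAuniv _ h
      · rw [followerSet_of_not_released hT hr] at h
        exact hr ((hrel i).2 (Or.inr (Or.inl h)) r)
    · exact hAuniv n h

/-! ### The ascending family is strictly increasing, exhaustive and uniformly r.e. -/

section Ascending

variable {η : Setoid ℕ}

theorem exists_leastInClass (η : Setoid ℕ) (x : ℕ) :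
    ∃ r ≤ x, η x r ∧ ∀ y, η r y → r ≤ y := by
  classical
  have h : ∃ r, η x r := ⟨x, η.refl x⟩
  exact ⟨Nat.find h, Nat.find_min' h (η.refl x), Nat.find_spec h,
    fun y hy => Nat.find_min' h (η.trans (Nat.find_spec h) hy)⟩

theorem infinite_leastInClass (hinf : η.classes.Infinite) :
    {x | ∀ y, η x y → x ≤ y}.Infinite := by
  intro hfin
  refine hinf ((hfin.image fun r => {x | η x r}).subset ?_)
  rintro _ ⟨x, rfl⟩
  obtain ⟨r, -, hxr, hr⟩ := exists_leastInClass η x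
  exact ⟨r, hr, Set.ext fun z => ⟨fun h => η.trans h (η.symm hxr), fun h => η.trans h hxr⟩⟩

theorem leastRep_le_of_rel (hinf : η.classes.Infinite) {n y : ℕ} (h : η (leastRep η n) y) :
    leastRep η n ≤ y :=
  Nat.nth_mem_of_infinite (infinite_leastInClass hinf) n y h

theorem leastRep_strictMono (hinf : η.classes.Infinite) : StrictMono (leastRep η) :=
  Nat.nth_strictMono (infinite_leastInClass hinf)

theorem leastRep_rel_iff (hinf : η.classes.Infinite) {m n : ℕ} :
    η (leastRep η m) (leastRep η n) ↔ m = n := by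
  constructor
  · intro h
    exact (leastRep_strictMono hinf).injective
      (le_antisymm (leastRep_le_of_rel hinf h) (leastRep_le_of_rel hinf (η.symm h)))
  · rintro rfl
    exact η.refl _

theorem exists_rel_leastRep (η : Setoid ℕ) (x : ℕ) :
    ∃ m, η x (leastRep η m) ∧ leastRep η m ≤ x := by
  classical
  obtain ⟨r, hrx, hxr, hr⟩ := exists_leastInClass η x
  have h : leastRep η (Nat.count (fun x => ∀ y, η x y → x ≤ y) r) = r := Nat.nth_count hr
  exact ⟨_, by rwa [h], by rwa [h]⟩

theorem leastRep_mem_ascendingSet_iff (hinf : η.classes.Infinite) {m n : ℕ} :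
    leastRep η m ∈ ascendingSet η n ↔ m < n := by
  constructor
  · rintro ⟨k, hk, h⟩
    rwa [(leastRep_rel_iff hinf).1 h]
  · exact fun h => ⟨m, h, η.refl _⟩

theorem ascendingSet_strictMono (hinf : η.classes.Infinite) : StrictMono (ascendingSet η) := by
  refine strictMono_nat_of_lt_succ fun n => ?_
  refine Set.ssubset_iff_exists.2 ⟨fun x ⟨m, hm, h⟩ => ⟨m, by omega, h⟩, leastRep η n, ?_, ?_⟩
  · exact (leastRep_mem_ascendingSet_iff hinf).2 n.lt_succ_self
  · exact fun h => lt_irrefl n ((leastRep_mem_ascendingSet_iff hinf).1 h)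

theorem mem_ascendingSet_of_lt (hinf : η.classes.Infinite) {n x : ℕ} (h : x < n) :
    x ∈ ascendingSet η n := by
  obtain ⟨m, hm, hmx⟩ := exists_rel_leastRep η x
  exact ⟨m, (((leastRep_strictMono hinf).le_apply).trans hmx).trans_lt h, hm⟩

/-- `x` lies in the `n`-th ascending set iff it is equivalent to some `y` such that `[0, y]` meets
at most `n` classes. -/
theorem mem_ascendingSet_iff (hinf : η.classes.Infinite) {n x : ℕ} :
    x ∈ ascendingSet η n ↔
      ∃ y, η x y ∧ ∃ l : List ℕ, l.length ≤ n ∧ ∀ z < y + 1, ∃ w ∈ l, η z w := by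
  constructor
  · rintro ⟨m, hm, h⟩
    -- The witness `y` is the representative `leastRep η m` itself: every class meeting `[0, y]` has
    -- its least element there, hence index at most `m < n`.
    refine ⟨_, h, (List.range n).map (leastRep η), by simp, fun z hz => ?_⟩
    obtain ⟨k, hk, hkz⟩ := exists_rel_leastRep η z
    refine ⟨_, List.mem_map.2 ⟨k, List.mem_range.2 (lt_of_le_of_lt ?_ hm), rfl⟩, hk⟩
    exact (leastRep_strictMono hinf).le_iff_le.1 (by omega)
  · rintro ⟨y, hxy, l, hl, h⟩
    obtain ⟨m, hm, hmy⟩ := exists_rel_leastRep η y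
    refine ⟨m, ?_, η.trans hxy hm⟩
    have h' : ∀ k < m + 1, ∃ w ∈ l, η (leastRep η k) w := fun k hk => by
      refine h _ (Nat.lt_succ_iff.2 (le_trans ?_ hmy))
      exact (leastRep_strictMono hinf).monotone (by omega)
    choose! f hf hηf using h'
    -- The first `m + 1` representatives lie in `[0, y]` and are pairwise inequivalent, so they need
    -- different list entries.
    have hcard : (Finset.range (m + 1)).card ≤ l.toFinset.card := by
      refine Finset.card_le_card_of_injOn f (fun k hk => ?_) ?_
      · simpa using hf k (by simpa using hk)
      · intro j hj k hk hjk
        have hj' := hηf j (by simpa using hj)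
        have hk' := hηf k (by simpa using hk)
        rw [hjk] at hj'
        exact (leastRep_rel_iff hinf).1 (η.trans hj' (η.symm hk'))
    rw [Finset.card_range] at hcard
    have := l.toFinset_card_le
    omega

/-- Being a least representative is only a co-r.e. condition; `mem_ascendingSet_iff` avoids it by
using positive occurrences of `η` alone. -/
theorem rePred_mem_ascendingSet (hη : IsPositive η) (hinf : η.classes.Infinite) :
    REPred fun z : ℕ × ℕ => z.2 ∈ ascendingSet η z.1 := by
  obtain ⟨q, hq, hmono, -, hqη⟩ := hη.exists_stages
  -- Finitely many `z` share one stage bound, which moves the unbounded search outside the bounded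
  -- quantifiers.
  have hcover : ∀ (y : ℕ) (l : List ℕ), (∀ z < y + 1, ∃ w ∈ l, η z w) ↔
      ∃ s, ∀ z < y + 1, ∃ w ∈ l, q (z, w) s := by
    intro y l
    constructor
    · intro h
      have h' : ∀ᶠ s in Filter.atTop, ∀ z < y + 1, ∃ w ∈ l, q (z, w) s := by
        refine (Filter.eventually_all_finite (Set.finite_lt_nat (y + 1))).2 fun z hz => ?_
        obtain ⟨w, hw, hzw⟩ := h z hz
        obtain ⟨s, hs⟩ := (hqη (z, w)).1 hzw
        filter_upwards [Filter.eventually_ge_atTop s] with t ht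
        exact ⟨w, hw, hmono _ _ _ ht hs⟩
      exact h'.exists
    · rintro ⟨s, hs⟩ z hz
      obtain ⟨w, hw, h⟩ := hs z hz
      exact ⟨w, hw, (hqη (z, w)).2 ⟨s, h⟩⟩
  refine REPred.of_eq ?_ fun z => (mem_ascendingSet_iff hinf).symm
  refine REPred.exists_of (p := fun (z : ℕ × ℕ) y =>
    η z.2 y ∧ ∃ l : List ℕ, l.length ≤ z.1 ∧ ∀ u < y + 1, ∃ w ∈ l, η u w) (REPred.and ?_ ?_)
  · exact hη.comp (f := fun v : (ℕ × ℕ) × ℕ => (v.1.2, v.2))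
      (Computable.pair (Computable.snd.comp Computable.fst) Computable.snd)
  · refine REPred.exists_of (p := fun (v : (ℕ × ℕ) × ℕ) (l : List ℕ) =>
      l.length ≤ v.1.1 ∧ ∀ u < v.2 + 1, ∃ w ∈ l, η u w) (REPred.and ?_ ?_)
    · exact PrimrecPred.rePred (Primrec.nat_le.comp (Primrec.list_length.comp Primrec.snd)
        (Primrec.fst.comp (Primrec.fst.comp Primrec.fst)))
    · simp only [hcover]
      refine REPred.exists_nat (q := fun (v : ((ℕ × ℕ) × ℕ) × List ℕ) s =>
        ∀ u < v.1.2 + 1, ∃ w ∈ v.2, q (u, w) s) ?_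
      refine PrimrecPred.forall_lt_param (p := fun (v : (((ℕ × ℕ) × ℕ) × List ℕ) × ℕ) u =>
        ∃ w ∈ v.1.2, q (u, w) v.2) ?_
        (Primrec.succ.comp (Primrec.snd.comp (Primrec.fst.comp Primrec.fst)))
      refine PrimrecPred.exists_mem_list_param
        (p := fun (v : ((((ℕ × ℕ) × ℕ) × List ℕ) × ℕ) × ℕ) w => q (v.2, w) v.1.2) ?_
        (Primrec.snd.comp (Primrec.fst.comp Primrec.fst))
      exact hq.comp (Primrec.pair (Primrec.pair (Primrec.snd.comp Primrec.fst) Primrec.snd)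
        (Primrec.snd.comp (Primrec.fst.comp Primrec.fst)))

end Ascending

/-! ### Saturation under `η`. -/

section Saturation

variable {η : Setoid ℕ}

/-- The union of the `η`-classes that meet `X`. -/
def etaSaturation (η : Setoid ℕ) (X : Set ℕ) : Set ℕ := {x | ∃ y, η x y ∧ y ∈ X}

theorem etaSaturation_eq_sUnion (η : Setoid ℕ) (X : Set ℕ) :
    etaSaturation η X = ⋃₀ ((fun y => {x | η x y}) '' X) := by
  ext x
  simp [etaSaturation, and_comm]

theorem image_class_subset (η : Setoid ℕ) (X : Set ℕ) :
    (fun y => {x | η x y}) '' X ⊆ η.classes := by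
  rintro _ ⟨y, -, rfl⟩
  exact ⟨y, rfl⟩

theorem isEtaClosed_etaSaturation (η : Setoid ℕ) (X : Set ℕ) :
    IsEtaClosed η (etaSaturation η X) := by
  rcases Set.finite_or_infinite ((fun y => {x | η x y}) '' X) with h | h
  · exact Or.inl ⟨_, image_class_subset η X, h, etaSaturation_eq_sUnion η X⟩
  · exact Or.inr ⟨_, image_class_subset η X, h, etaSaturation_eq_sUnion η X⟩

theorem isEtaFinite_etaSaturation (η : Setoid ℕ) {X : Set ℕ} (hX : X.Finite) :
    IsEtaFinite η (etaSaturation η X) :=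
  ⟨_, image_class_subset η X, hX.image _, etaSaturation_eq_sUnion η X⟩

theorem etaSaturation_eq_self_of_sUnion {D : Set (Set ℕ)} (hD : D ⊆ η.classes) :
    etaSaturation η (⋃₀ D) = ⋃₀ D := by
  ext x
  constructor
  · rintro ⟨y, hxy, c, hc, hy⟩
    obtain ⟨z, rfl⟩ := hD hc
    exact ⟨_, hc, η.trans hxy hy⟩
  · exact fun hx => ⟨x, η.refl x, hx⟩

/-- With `isEtaClosed_etaSaturation`, this lets saturating all `W e` list exactly the closed r.e.
sets, with no need to recognise closedness. -/
theorem IsEtaClosed.etaSaturation_eq {X : Set ℕ} (h : IsEtaClosed η X) :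
    etaSaturation η X = X := by
  obtain ⟨D, hD, -, rfl⟩ | ⟨D, hD, -, rfl⟩ := h <;> exact etaSaturation_eq_self_of_sUnion hD

theorem IsEtaFinite.exists_list {X : Set ℕ} (h : IsEtaFinite η X) :
    ∃ l : List ℕ, etaSaturation η {x | x ∈ l} = X := by
  obtain ⟨D, hD, hfin, rfl⟩ := h
  choose! f hf using hD
  refine ⟨hfin.toFinset.toList.map f, ?_⟩
  ext x
  simp only [etaSaturation, Set.mem_ofPred_eq, List.mem_map, Finset.mem_toList,
    Set.Finite.mem_toFinset, Set.mem_sUnion]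
  constructor
  · rintro ⟨_, hx, c, hc, rfl⟩
    exact ⟨c, hc, by rw [hf hc]; exact hx⟩
  · rintro ⟨c, hc, hx⟩
    rw [hf hc] at hx
    exact ⟨_, hx, c, hc, rfl⟩

theorem ascendingSet_eq_etaSaturation (η : Setoid ℕ) (n : ℕ) :
    ascendingSet η n = etaSaturation η (leastRep η '' Set.Iio n) := by
  ext x
  constructor
  · rintro ⟨m, hm, h⟩
    exact ⟨_, h, m, hm, rfl⟩
  · rintro ⟨_, h, m, hm, rfl⟩
    exact ⟨m, hm, h⟩

theorem isEtaFinite_ascendingSet (η : Setoid ℕ) (n : ℕ) : IsEtaFinite η (ascendingSet η n) := by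
  rw [ascendingSet_eq_etaSaturation]
  exact isEtaFinite_etaSaturation η ((Set.finite_Iio n).image _)

theorem rePred_mem_etaSaturation (hη : IsPositive η) {L : ℕ → Set ℕ}
    (hL : REPred fun z : ℕ × ℕ => z.2 ∈ L z.1) :
    REPred fun z : ℕ × ℕ => z.2 ∈ etaSaturation η (L z.1) := by
  refine REPred.exists_of (p := fun (z : ℕ × ℕ) y => η z.2 y ∧ y ∈ L z.1) (REPred.and ?_ ?_)
  · exact hη.comp (f := fun v : (ℕ × ℕ) × ℕ => (v.1.2, v.2))
      (Computable.pair (Computable.snd.comp Computable.fst) Computable.snd)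
  · exact hL.comp (f := fun v : (ℕ × ℕ) × ℕ => (v.1.1, v.2))
      (Computable.pair (Computable.fst.comp Computable.fst) Computable.snd)

end Saturation

/-! ### The proposition and the two named classes. -/

theorem isEtaFamily_range {η : Setoid ℕ} (hη : IsPositive η) (hinf : η.classes.Infinite)
    {L : ℕ → Set ℕ} (hL : REPred fun z : ℕ × ℕ => z.2 ∈ L z.1)
    (hsub : ascendingFamily η ⊆ Set.range L) (hclosed : ∀ X ∈ Set.range L, IsEtaClosed η X) :
    IsEtaFamily η (Set.range L) :=
  ⟨(Set.infinite_range_of_injective (ascendingSet_strictMono hinf).injective).mono hsub,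
    oneOneRE_range hL (rePred_mem_ascendingSet hη hinf) (ascendingSet_strictMono hinf)
      (fun _ _ h => mem_ascendingSet_of_lt hinf h) hsub, hclosed⟩

/-- A uniformly r.e. class containing the empty set is the range of a uniformly r.e. sequence. -/
theorem UniformlyRE.exists_range {C : Set (Set ℕ)} (hC : UniformlyRE C) (h : ∅ ∈ C) :
    ∃ L : ℕ → Set ℕ, REPred (fun z : ℕ × ℕ => z.2 ∈ L z.1) ∧ C = Set.range L := by
  obtain ⟨S, hS, rfl⟩ := hC
  -- Indices outside `S` yield `∅`, which is harmless because `∅` is a member.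
  refine ⟨fun i => {x | i ∈ S ∧ x ∈ W i}, (hS.comp Computable.fst).and rePred_mem_W, ?_⟩
  apply Set.Subset.antisymm
  · rintro _ ⟨i, hi, rfl⟩
    exact ⟨i, by simp [hi]⟩
  · rintro _ ⟨i, rfl⟩
    by_cases hi : i ∈ S
    · exact ⟨i, hi, by simp [hi]⟩
    · simpa [hi] using h

theorem proposition4p3 (η : Setoid ℕ) (hη : IsPositive η) (hinf : η.classes.Infinite) :
    (∀ C : Set (Set ℕ), UniformlyRE C → ascendingFamily η ⊆ C →
        (∀ L ∈ C, IsEtaClosed η L) → IsEtaFamily η C) ∧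
      IsEtaFamily η {L | IsEtaFinite η L} ∧
      IsEtaFamily η {L | IsEtaClosed η L ∧ REPred (fun x => x ∈ L)} := by
  refine ⟨fun C hC hsub hclosed => ?_, ?_, ?_⟩
  -- The ascending set with index `0` is empty.
  · have h0 : ∅ ∈ C := hsub ⟨0, by ext; simp [ascendingSet]⟩
    obtain ⟨L, hL, rfl⟩ := hC.exists_range h0
    exact isEtaFamily_range hη hinf hL hsub hclosed
  · have hL : REPred fun z : ℕ × ℕ => z.2 ∈ {x | x ∈ Denumerable.ofNat (List ℕ) z.1} := by
      refine PrimrecPred.rePred ((PrimrecPred.exists_mem_list_param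
        (p := fun (z : ℕ × ℕ) x => z.2 = x) (f := fun z => Denumerable.ofNat (List ℕ) z.1)
        (Primrec.eq.comp (Primrec.snd.comp Primrec.fst) Primrec.snd)
        ((Primrec.ofNat _).comp Primrec.fst)).of_eq fun z => by simp)
    have heq : {L | IsEtaFinite η L} = Set.range fun n =>
        etaSaturation η {x | x ∈ Denumerable.ofNat (List ℕ) n} := by
      apply Set.Subset.antisymm
      · intro X hX
        obtain ⟨l, rfl⟩ := hX.exists_list
        exact ⟨Encodable.encode l, by simp⟩
      · rintro _ ⟨n, rfl⟩
        exact isEtaFinite_etaSaturation η (List.finite_toSet _)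
    have hclosed : ∀ X ∈ {L | IsEtaFinite η L}, IsEtaClosed η X := fun X hX => Or.inl hX
    have hsub : ascendingFamily η ⊆ {L | IsEtaFinite η L} := by
      rintro _ ⟨n, rfl⟩
      exact isEtaFinite_ascendingSet η n
    rw [heq] at hclosed hsub ⊢
    exact isEtaFamily_range hη hinf (rePred_mem_etaSaturation hη
      (L := fun n => {x | x ∈ Denumerable.ofNat (List ℕ) n}) hL) hsub hclosed
  · have heq : {L | IsEtaClosed η L ∧ REPred (fun x => x ∈ L)} =
        Set.range fun e => etaSaturation η (W e) := by
      apply Set.Subset.antisymm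
      · rintro X ⟨hX, hre⟩
        obtain ⟨e, rfl⟩ := W_surjective hre
        exact ⟨e, hX.etaSaturation_eq⟩
      · rintro _ ⟨e, rfl⟩
        exact ⟨isEtaClosed_etaSaturation η _, (rePred_mem_etaSaturation hη rePred_mem_W).comp
          (f := fun x => (e, x)) (Computable.pair (Computable.const e) Computable.id)⟩
    have hclosed : ∀ X ∈ {L | IsEtaClosed η L ∧ REPred (fun x => x ∈ L)}, IsEtaClosed η X :=
      fun X hX => hX.1
    have hsub : ascendingFamily η ⊆ {L | IsEtaClosed η L ∧ REPred (fun x => x ∈ L)} := by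
      rintro _ ⟨n, rfl⟩
      exact ⟨Or.inl (isEtaFinite_ascendingSet η n), (rePred_mem_ascendingSet hη hinf).comp
        (f := fun x => (n, x)) (Computable.pair (Computable.const n) Computable.id)⟩
    rw [heq] at hclosed hsub ⊢
    exact isEtaFamily_range hη hinf (rePred_mem_etaSaturation hη rePred_mem_W) hsub hclosed
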